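/- Let $G$ be a compact Lie group, $\rho$ a $k$-dimensional unitary representation of $G$ ($k\ge 1$), and $\tau(g)=\frac1k\operatorname{tr}\rho(g)$. Let $M$ be a real-analytic $n$-manifold, $P\to M$ a smooth principal $G$-bundle, and $\mathcal A$ the space of smooth connections on $P$. A *loop* is a continuous map $\gamma\colon S^1\to M$ such that $S^1$ is a finite union of closed intervals on each of which $\gamma$ extends to a real-analytic function on a larger open interval; a *multiloop* is a finite tuple $\gamma=(\gamma_1,\dots,\gamma_m)$ of loops, for any $m\ge 0$. For a loop $\gamma$ let $T(\gamma)\colon\mathcal A\to\mathbb C$ be the bounded function sending $A$ to $\tau$ of the holonomy of $A$ around $\gamma$. Let $\mathcal H_0$ be the unital algebra of functions on $\mathcal A$ generated by all $T(\gamma)$, $\mathcal H$ its closure in the supremum norm, and $\mathcal H^*$ the space of continuous linear functionals on $\mathcal H$. Let $\mathrm{Diff}_0(M)$ be the connected component of the identity in the group of real-analytic diffeomorphisms of $M$ with the $C^\infty$ compact-open topology; it acts on $\mathcal H$ by the algebra automorphisms determined by $g\,T(\gamma)=T(g\circ\gamma)$. Let $\mathcal H^*_{inv}$ be the set of $\mu\in\mathcal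 H^*$ with $\mu(gf)=\mu(f)$ for all $g\in \mathrm{Diff}_0(M)$ and $f\in\mathcal H$. Two multiloops $\gamma,\eta$ of the same length are *ambient isotopic* if for some $g\in\mathrm{Diff}_0(M)$ one has $\gamma_i=g\circ\eta_i$ for all $i$. Then for every $\mu\in\mathcal H^*_{inv}$ the function $$\mathcal L_\mu(\gamma)=\mu\bigl(T(\gamma_1)\cdots T(\gamma_m)\bigr)$$ of multiloops is an ambient isotopy invariant, that is, $\mathcal L_\mu(\gamma)=\mathcal L_\mu(\eta)$ whenever $\gamma$ and $\eta$ are ambient isotopic. Moreover, the map $\mu\mapsto\mathcal L_\mu$ on $\mathcal H^*_{inv}$ is injective. -/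

import Mathlib

open scoped Manifold ContDiff ENNReal

noncomputable section

namespace WilsonLoops

/-! ### Analytic diffeomorphisms and the identity component -/

section Diffeos

variable (n : ℕ) (M : Type*) [TopologicalSpace M] [ChartedSpace (EuclideanSpace ℝ (Fin n)) M]

/-- The real-analytic diffeomorphisms of the `n`-manifold `M`. -/
abbrev AnalyticDiffeo : Type _ := M ≃ₘ^ω⟮𝓡 n, 𝓡 n⟯ M

variable {n M}

/-- The basic neighbourhood of `f` for the `C^∞` compact-open topology: all `g` that map the
compact set `K` (contained in the domain of the chart `φ`) into the domain of the chart `ψ`, and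
whose derivatives of order at most `r`, read in the charts `φ` and `ψ`, are `ε`-close on `K` to
those of `f`. -/
def basicNhd (f : AnalyticDiffeo n M)
    (φ ψ : OpenPartialHomeomorph M (EuclideanSpace ℝ (Fin n))) (K : Set M) (r : ℕ) (ε : ℝ) :
    Set (AnalyticDiffeo n M) :=
  {g | Set.MapsTo g K ψ.source ∧ ∀ x ∈ K, ∀ j ≤ r,
    ‖iteratedFDeriv ℝ j (fun y => ψ (g (φ.symm y))) (φ x) -
      iteratedFDeriv ℝ j (fun y => ψ (f (φ.symm y))) (φ x)‖ < ε}

variable (n M)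

/-- The `C^∞` compact-open topology on the group of analytic diffeomorphisms of `M`. -/
@[reducible]
def diffeoTopology : TopologicalSpace (AnalyticDiffeo n M) :=
  TopologicalSpace.generateFrom
    {N | ∃ (f : AnalyticDiffeo n M)
      (φ ψ : OpenPartialHomeomorph M (EuclideanSpace ℝ (Fin n))) (K : Set M) (r : ℕ) (ε : ℝ),
      φ ∈ IsManifold.maximalAtlas (𝓡 n) ω M ∧ ψ ∈ IsManifold.maximalAtlas (𝓡 n) ω M ∧
      IsCompact K ∧ K ⊆ φ.source ∧ Set.MapsTo f K ψ.source ∧ 0 < ε ∧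
      N = basicNhd f φ ψ K r ε}

/-- `Diff₀(M)`: the connected component of the identity in the group of analytic
diffeomorphisms. -/
def identityComponent : Set (AnalyticDiffeo n M) :=
  @connectedComponent _ (diffeoTopology n M) (Diffeomorph.refl (𝓡 n) M ω)

end Diffeos

/-! ### Piecewise analytic loops -/

section Loops

variable (n : ℕ) (M : Type*) [TopologicalSpace M] [ChartedSpace (EuclideanSpace ℝ (Fin n)) M]

/-- A loop: a continuous map `S¹ → M`, where `S¹ = ℝ / ℤ`, such that `S¹` is a finite union of
closed intervals on each of which the map extends to a real-analytic function on a larger open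
interval. -/
structure Loop where
  toFun : UnitAddCircle → M
  continuous_toFun : Continuous toFun
  piecewise_analytic : ∃ (m : ℕ) (a b : Fin m → ℝ),
    (∀ s : UnitAddCircle, ∃ i, ∃ t ∈ Set.Icc (a i) (b i), (t : UnitAddCircle) = s) ∧
    ∀ i, ∃ ε > 0, ∃ c : ℝ → M,
      ContMDiffOn 𝓘(ℝ) (𝓡 n) ω c (Set.Ioo (a i - ε) (b i + ε)) ∧
      ∀ t ∈ Set.Icc (a i) (b i), c t = toFun (t : UnitAddCircle)

variable {n M}

/-- The loop `g ∘ γ`. -/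
def Loop.comp (g : AnalyticDiffeo n M) (γ : Loop n M) : Loop n M where
  toFun s := g (γ.toFun s)
  continuous_toFun := g.continuous.comp γ.continuous_toFun
  piecewise_analytic := by
    obtain ⟨m, a, b, hcov, hc⟩ := γ.piecewise_analytic
    refine ⟨m, a, b, hcov, fun i => ?_⟩
    obtain ⟨ε, hε, c, hc1, hc2⟩ := hc i
    exact ⟨ε, hε, fun t => g (c t), g.contMDiff.comp_contMDiffOn hc1,
      fun t ht => congrArg g (hc2 t ht)⟩

variable (n M)

/-- A multiloop: an `m`-tuple of loops, for some `m`. -/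
abbrev Multiloop : Type _ := Σ m : ℕ, Fin m → Loop n M

variable {n M}

/-- `γ` and `η` are ambient isotopic if `γ_i = g ∘ η_i` for all `i`, for some `g ∈ Diff₀(M)`. -/
def AmbientIsotopic (γ η : Multiloop n M) : Prop :=
  ∃ g ∈ identityComponent n M, γ = ⟨η.1, fun i => (η.2 i).comp g⟩

/-- A function of multiloops is an ambient isotopy invariant if it takes equal values on ambient
isotopic multiloops. -/
def IsAmbientIsotopyInvariant (L : Multiloop n M → ℂ) : Prop :=
  ∀ γ η : Multiloop n M, AmbientIsotopic γ η → L γ = L η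

end Loops

/-! ### Principal bundles, connections and holonomy -/

section Bundles

variable (n : ℕ)
  (EG G : Type*) [NormedAddCommGroup EG] [NormedSpace ℝ EG]
  [TopologicalSpace G] [ChartedSpace EG G] [Group G]
  (M : Type*) [TopologicalSpace M] [ChartedSpace (EuclideanSpace ℝ (Fin n)) M]
  (EP P : Type*) [NormedAddCommGroup EP] [NormedSpace ℝ EP]
  [TopologicalSpace P] [ChartedSpace EP P]

/-- A smooth principal `G`-bundle structure on the manifold `P` over `M`: a smooth projection and
a smooth right action of `G` along the fibres, with `G`-equivariant smooth local
trivialisations. -/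
structure PrincipalBundle where
  proj : P → M
  act : P → G → P
  act_one : ∀ p, act p 1 = p
  act_mul : ∀ p g h, act p (g * h) = act (act p g) h
  proj_act : ∀ p g, proj (act p g) = proj p
  contMDiff_proj : ContMDiff 𝓘(ℝ, EP) (𝓡 n) ∞ proj
  contMDiff_act : ContMDiff (𝓘(ℝ, EP).prod 𝓘(ℝ, EG)) 𝓘(ℝ, EP) ∞
    (fun x : P × G => act x.1 x.2)
  locally_trivial : ∀ x : M, ∃ (U : Set M) (φ : OpenPartialHomeomorph P (M × G)),
    IsOpen U ∧ x ∈ U ∧ φ.source = proj ⁻¹' U ∧ φ.target = U ×ˢ Set.univ ∧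
    ContMDiffOn 𝓘(ℝ, EP) ((𝓡 n).prod 𝓘(ℝ, EG)) ∞ φ φ.source ∧
    ContMDiffOn ((𝓡 n).prod 𝓘(ℝ, EG)) 𝓘(ℝ, EP) ∞ φ.symm φ.target ∧
    ∀ p ∈ φ.source, (φ p).1 = proj p ∧ ∀ g, (φ (act p g)).2 = (φ p).2 * g

variable {n EG G M EP P}

/-- A smooth connection on the principal bundle `B`, given by its connection form: a smooth
1-form on `P` with values in the Lie algebra of `G` that reproduces the generators of the
`G`-action and is equivariant, `R_g^* ω = Ad(g⁻¹) ω`. Smoothness is that of the associated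
function on the tangent bundle of `P`. -/
structure Connection [IsManifold 𝓘(ℝ, EP) ∞ P] (B : PrincipalBundle n EG G M EP P) where
  form : ∀ p : P, TangentSpace 𝓘(ℝ, EP) p →L[ℝ] GroupLieAlgebra 𝓘(ℝ, EG) G
  smooth : ContMDiff (M' := EG) 𝓘(ℝ, EP).tangent 𝓘(ℝ, EG) ∞
    (fun v : TangentBundle 𝓘(ℝ, EP) P => form v.proj v.snd)
  vertical : ∀ (p : P) (X : GroupLieAlgebra 𝓘(ℝ, EG) G),
    form (B.act p 1) (mfderiv 𝓘(ℝ, EG) 𝓘(ℝ, EP) (fun g => B.act p g) (1 : G) X) = X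
  equivariant : ∀ (p : P) (g : G) (v : TangentSpace 𝓘(ℝ, EP) p),
    form (B.act p g) (mfderiv 𝓘(ℝ, EP) 𝓘(ℝ, EP) (fun q => B.act q g) p v) =
      mfderiv 𝓘(ℝ, EG) 𝓘(ℝ, EG) (fun h : G => g⁻¹ * h * g) (1 : G) (form p v)

variable [IsManifold 𝓘(ℝ, EP) ∞ P] {B : PrincipalBundle n EG G M EP P}

/-- `c` is a horizontal lift on `[0, 1]` of the loop `γ`: continuous, over `γ`, and, outside a
finite set of times, differentiable with velocity in the kernel of the connection form. -/
def IsHorizontalLift (A : Connection B) (γ : Loop n M) (c : ℝ → P) : Prop :=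
  ContinuousOn c (Set.Icc 0 1) ∧
  (∀ t ∈ Set.Icc (0 : ℝ) 1, B.proj (c t) = γ.toFun (t : UnitAddCircle)) ∧
  ∃ S : Set ℝ, S.Finite ∧ ∀ t ∈ Set.Ioo (0 : ℝ) 1 \ S,
    MDifferentiableAt 𝓘(ℝ) 𝓘(ℝ, EP) c t ∧
    A.form (c t) (mfderiv 𝓘(ℝ) 𝓘(ℝ, EP) c t (1 : ℝ)) = 0

/-- `h` is the holonomy of `A` around `γ` at some point of the fibre over `γ(0)`: the end point of
a horizontal lift is its starting point moved by `h`. -/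
def IsHolonomy (A : Connection B) (γ : Loop n M) (h : G) : Prop :=
  ∃ c : ℝ → P, IsHorizontalLift A γ c ∧ c 1 = B.act (c 0) h

/-- The holonomy of `A` around `γ`, at an unspecified point of the fibre over `γ(0)`. The elements
satisfying `IsHolonomy A γ` form one conjugacy class, so that class functions do not depend on
the choice. -/
def holonomy (A : Connection B) (γ : Loop n M) : G :=
  Classical.epsilon (IsHolonomy A γ)

/-! ### Wilson loops and the holonomy algebra -/

variable {k : ℕ}

/-- The normalised trace `τ(g) = tr(ρ(g)) / k` of a `k`-dimensional unitary representation. -/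
def tau (ρ : G →ₜ* Matrix.unitaryGroup (Fin k) ℂ) (g : G) : ℂ :=
  (1 / (k : ℂ)) * Matrix.trace (ρ g : Matrix (Fin k) (Fin k) ℂ)

theorem norm_tau_le (ρ : G →ₜ* Matrix.unitaryGroup (Fin k) ℂ) (g : G) : ‖tau ρ g‖ ≤ 1 := by
  have h1 : ‖Matrix.trace (ρ g : Matrix (Fin k) (Fin k) ℂ)‖ ≤ k := by
    refine (norm_sum_le _ _).trans ?_
    refine (Finset.sum_le_card_nsmul _ _ 1 fun i _ => ?_).trans (by simp)
    exact entry_norm_bound_of_unitary (ρ g).2 i i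
  rw [tau, norm_mul, norm_div, norm_one, Complex.norm_natCast, one_div_mul_eq_div]
  exact div_le_one_of_le₀ h1 (Nat.cast_nonneg k)

/-- The bounded complex functions on the space of connections, with the supremum norm. -/
abbrev BoundedFunctions (B : PrincipalBundle n EG G M EP P) : Type _ :=
  lp (fun _ : Connection B => ℂ) ∞

/-- The Wilson loop `T(γ)`, the function `A ↦ τ(holonomy of A around γ)`. -/
def wilson (B : PrincipalBundle n EG G M EP P) (ρ : G →ₜ* Matrix.unitaryGroup (Fin k) ℂ)
    (γ : Loop n M) : BoundedFunctions B :=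
  ⟨fun A => tau ρ (holonomy A γ), memℓp_infty ⟨1, by
    rintro _ ⟨A, rfl⟩
    exact norm_tau_le ρ _⟩⟩

/-- The algebra `H₀` generated by the Wilson loops. -/
def holonomyAlgebra₀ (B : PrincipalBundle n EG G M EP P)
    (ρ : G →ₜ* Matrix.unitaryGroup (Fin k) ℂ) : Subalgebra ℂ (BoundedFunctions B) :=
  Algebra.adjoin ℂ (Set.range (wilson B ρ))

/-- The holonomy algebra `H`: the closure of `H₀` in the supremum norm. -/
def holonomyAlgebra (B : PrincipalBundle n EG G M EP P)
    (ρ : G →ₜ* Matrix.unitaryGroup (Fin k) ℂ) : Subalgebra ℂ (BoundedFunctions B) :=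
  (holonomyAlgebra₀ B ρ).topologicalClosure

/-- The Wilson loop `T(γ)` as an element of `H`. -/
def wilsonLoop (B : PrincipalBundle n EG G M EP P) (ρ : G →ₜ* Matrix.unitaryGroup (Fin k) ℂ)
    (γ : Loop n M) : holonomyAlgebra B ρ :=
  ⟨wilson B ρ γ, Subalgebra.le_topologicalClosure _
    (Algebra.subset_adjoin (Set.mem_range_self γ))⟩

/-- The graph of the action of `g` on `H`, i.e. of the automorphism determined by
`g T(γ) = T(g ∘ γ)`: the closed subalgebra of `H × H` generated by the pairs
`(T(γ), T(g ∘ γ))`. -/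
def actionGraph (B : PrincipalBundle n EG G M EP P) (ρ : G →ₜ* Matrix.unitaryGroup (Fin k) ℂ)
    (g : AnalyticDiffeo n M) : Subalgebra ℂ (holonomyAlgebra B ρ × holonomyAlgebra B ρ) :=
  (Algebra.adjoin ℂ (Set.range fun γ : Loop n M =>
    (wilsonLoop B ρ γ, wilsonLoop B ρ (γ.comp g)))).topologicalClosure

/-- If `α` is the automorphism of `H` with `α T(γ) = T(g ∘ γ)`, then `actionGraph B ρ g` is
precisely the graph of `α`. -/
theorem mem_actionGraph_iff (B : PrincipalBundle n EG G M EP P)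
    (ρ : G →ₜ* Matrix.unitaryGroup (Fin k) ℂ) (g : AnalyticDiffeo n M)
    (α : holonomyAlgebra B ρ →ₐ[ℂ] holonomyAlgebra B ρ) (hα : Continuous α)
    (hT : ∀ γ, α (wilsonLoop B ρ γ) = wilsonLoop B ρ (γ.comp g)) (f f' : holonomyAlgebra B ρ) :
    (f, f') ∈ actionGraph B ρ g ↔ f' = α f := by
  constructor
  · have hcl : IsClosed {x : holonomyAlgebra B ρ × holonomyAlgebra B ρ | x.2 = α x.1} :=
      isClosed_eq continuous_snd (hα.comp continuous_fst)
    intro h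
    refine hcl.closure_subset_iff.mpr ?_ h
    intro x hx
    refine Algebra.adjoin_induction (p := fun x _ => x.2 = α x.1) ?_ ?_ ?_ ?_ hx
    · rintro _ ⟨γ, rfl⟩
      exact (hT γ).symm
    · intro r
      exact (α.commutes r).symm
    · intro x y _ _ hx hy
      simp [hx, hy]
    · intro x y _ _ hx hy
      simp [hx, hy]
  · rintro rfl
    have hcl : IsClosed {x : holonomyAlgebra B ρ | (x, α x) ∈ actionGraph B ρ g} :=
      (Subalgebra.isClosed_topologicalClosure _).preimage (continuous_id.prodMk hα)
    obtain ⟨a, ha⟩ := f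
    have key : ∀ a (ha : a ∈ holonomyAlgebra₀ B ρ),
        ((⟨a, Subalgebra.le_topologicalClosure _ ha⟩ : holonomyAlgebra B ρ),
          α ⟨a, Subalgebra.le_topologicalClosure _ ha⟩) ∈ actionGraph B ρ g := by
      intro a ha
      induction ha using Algebra.adjoin_induction with
      | mem x hx =>
        obtain ⟨γ, rfl⟩ := hx
        have : (wilsonLoop B ρ γ, α (wilsonLoop B ρ γ)) ∈ actionGraph B ρ g := by
          rw [hT]
          exact Subalgebra.le_topologicalClosure _ (Algebra.subset_adjoin ⟨γ, rfl⟩)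
        exact this
      | algebraMap r =>
        have h1 : (algebraMap ℂ (holonomyAlgebra B ρ) r, α (algebraMap ℂ _ r)) ∈
            actionGraph B ρ g := by
          rw [α.commutes]
          exact (actionGraph B ρ g).algebraMap_mem r
        exact h1
      | add x y hx hy h1 h2 =>
        have := (actionGraph B ρ g).add_mem h1 h2
        rw [Prod.mk_add_mk, ← map_add] at this
        exact this
      | mul x y hx hy h1 h2 =>
        have := (actionGraph B ρ g).mul_mem h1 h2
        rw [Prod.mk_mul_mk, ← map_mul] at this
        exact this
    have hd : (⟨a, ha⟩ : holonomyAlgebra B ρ) ∈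
        closure {x : holonomyAlgebra B ρ | x.1 ∈ holonomyAlgebra₀ B ρ} := by
      rw [closure_subtype]
      refine closure_mono ?_ ha
      intro b hb
      exact ⟨⟨b, Subalgebra.le_topologicalClosure _ hb⟩, hb, rfl⟩
    exact hcl.closure_subset_iff.mpr (fun x hx => key x.1 hx) hd

/-- `H*_inv`: the continuous linear functionals `μ` on `H` that are invariant under the action of
`Diff₀(M)`, i.e. `μ(g f) = μ(f)` for all `g ∈ Diff₀(M)` and `f ∈ H`. -/
def invariantFunctionals (B : PrincipalBundle n EG G M EP P)
    (ρ : G →ₜ* Matrix.unitaryGroup (Fin k) ℂ) : Set (holonomyAlgebra B ρ →L[ℂ] ℂ) :=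
  {μ | ∀ g ∈ identityComponent n M, ∀ f gf : holonomyAlgebra B ρ,
    (f, gf) ∈ actionGraph B ρ g → μ gf = μ f}

/-- The function `L_μ(γ) = μ(T(γ_1) ⋯ T(γ_m))` of multiloops. -/
def loopTransform (B : PrincipalBundle n EG G M EP P)
    (ρ : G →ₜ* Matrix.unitaryGroup (Fin k) ℂ) (μ : holonomyAlgebra B ρ →L[ℂ] ℂ) :
    Multiloop n M → ℂ :=
  fun γ => μ (∏ i, wilsonLoop B ρ (γ.2 i))

end Bundles

end WilsonLoops

end

/-! Invariance: `g` acts on the holonomy algebra multiplicatively, so it carries a product of Wilson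
loops to the product of the translated ones, and an invariant `μ` takes the same value on both.
Since the action is encoded by its graph, a subalgebra of `H × H`, multiplicativity is just closure
of this subalgebra under finite products (`prod_wilsonLoop_mem_actionGraph`). Injectivity: `L_μ`
records `μ` on all monomials in the Wilson loops. These monomials span the algebra that the Wilson
loops generate, which is dense in `H` (`dense_adjoin_wilsonLoop`), so linearity and continuity
recover `μ`. -/

namespace WilsonLoops

section

variable {n k : ℕ}
  {EG G : Type*} [NormedAddCommGroup EG] [NormedSpace ℝ EG]
  [TopologicalSpace G] [ChartedSpace EG G] [Group G]
  {M : Type*} [TopologicalSpace M] [ChartedSpace (EuclideanSpace ℝ (Fin n)) M]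
  {EP P : Type*} [NormedAddCommGroup EP] [NormedSpace ℝ EP]
  [TopologicalSpace P] [ChartedSpace EP P] [IsManifold 𝓘(ℝ, EP) ∞ P]

/-- The action of `g` sends a product of Wilson loops to the product of the Wilson loops moved
by `g`. -/
theorem prod_wilsonLoop_mem_actionGraph (B : PrincipalBundle n EG G M EP P)
    (ρ : G →ₜ* Matrix.unitaryGroup (Fin k) ℂ) (g : AnalyticDiffeo n M) {m : ℕ}
    (γ : Fin m → Loop n M) :
    (∏ i, wilsonLoop B ρ (γ i), ∏ i, wilsonLoop B ρ ((γ i).comp g)) ∈ actionGraph B ρ g := by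
  have h : ∏ i, (wilsonLoop B ρ (γ i), wilsonLoop B ρ ((γ i).comp g)) ∈ actionGraph B ρ g :=
    prod_mem fun i _ => Subalgebra.le_topologicalClosure _ (Algebra.subset_adjoin ⟨γ i, rfl⟩)
  rwa [prod_mk_prod]

/-- The elements of the monoid generated by the range of `f` are the finite products of values
of `f`. -/
theorem exists_fin_prod_of_mem_closure_range {ι R : Type*} [CommMonoid R] {f : ι → R} {x : R}
    (hx : x ∈ Submonoid.closure (Set.range f)) : ∃ (m : ℕ) (γ : Fin m → ι), ∏ i, f (γ i) = x := by
  induction hx using Submonoid.closure_induction with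
  | mem x hx =>
    obtain ⟨i, rfl⟩ := hx
    exact ⟨1, fun _ => i, by simp⟩
  -- The unit is the empty product; this is where multiloops of length zero are needed.
  | one => exact ⟨0, Fin.elim0, by simp⟩
  | mul x y _ _ hx hy =>
    obtain ⟨a, γ, rfl⟩ := hx
    obtain ⟨b, η, rfl⟩ := hy
    exact ⟨a + b, Fin.append γ η, by simp [Fin.prod_univ_add]⟩

/-- The subalgebra generated by the Wilson loops is dense in the holonomy algebra. -/
theorem dense_adjoin_wilsonLoop (B : PrincipalBundle n EG G M EP P)
    (ρ : G →ₜ* Matrix.unitaryGroup (Fin k) ℂ) :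
    Dense (Algebra.adjoin ℂ (Set.range (wilsonLoop B ρ)) : Set (holonomyAlgebra B ρ)) := by
  rintro ⟨a, ha⟩
  -- Closure in `H` is tested in the ambient space of bounded functions, where `ha` says that `a` is
  -- a limit of elements of `H₀`.
  rw [closure_subtype]
  refine closure_mono ?_ ha
  intro b hb
  -- The inclusion of `H` is an algebra map taking generators to generators, so the algebra
  -- generated inside `H` has image exactly `H₀`.
  have h : (Algebra.adjoin ℂ (Set.range (wilsonLoop B ρ))).map (holonomyAlgebra B ρ).val =
      holonomyAlgebra₀ B ρ := by
    rw [AlgHom.map_adjoin, ← Set.range_comp]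
    rfl
  exact h.ge hb

/-- A continuous linear functional on the holonomy algebra is determined by its loop
transform. -/
theorem loopTransform_injective (B : PrincipalBundle n EG G M EP P)
    (ρ : G →ₜ* Matrix.unitaryGroup (Fin k) ℂ) : Function.Injective (loopTransform B ρ) := by
  intro μ ν h
  refine ContinuousLinearMap.coeFn_injective
    (μ.continuous.ext_on (dense_adjoin_wilsonLoop B ρ) ν.continuous fun x hx => ?_)
  -- Seen as a submodule, the generated algebra is the linear span of the multiplicative monoid on
  -- the same generators, so comparing `μ` and `ν` on monomials suffices.
  replace hx : x ∈ Subalgebra.toSubmodule (Algebra.adjoin ℂ (Set.range (wilsonLoop B ρ))) := hx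
  rw [Algebra.adjoin_eq_span] at hx
  refine LinearMap.eqOn_span (f := μ.toLinearMap) (g := ν.toLinearMap) (fun y hy => ?_) hx
  obtain ⟨m, γ, rfl⟩ := exists_fin_prod_of_mem_closure_range hy
  exact congrFun h ⟨m, γ⟩

end

end WilsonLoops

theorem proposition1
    {n k : ℕ} (hk : 0 < k)
    {M : Type*} [TopologicalSpace M] [T2Space M] [SecondCountableTopology M]
    [ChartedSpace (EuclideanSpace ℝ (Fin n)) M] [IsManifold (𝓡 n) ω M]
    {EG G : Type*} [NormedAddCommGroup EG] [NormedSpace ℝ EG] [FiniteDimensional ℝ EG]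
    [TopologicalSpace G] [ChartedSpace EG G] [Group G] [LieGroup 𝓘(ℝ, EG) ∞ G]
    [CompactSpace G] [T2Space G]
    {EP P : Type*} [NormedAddCommGroup EP] [NormedSpace ℝ EP] [FiniteDimensional ℝ EP]
    [TopologicalSpace P] [ChartedSpace EP P] [IsManifold 𝓘(ℝ, EP) ∞ P]
    (B : WilsonLoops.PrincipalBundle n EG G M EP P)
    (ρ : G →ₜ* Matrix.unitaryGroup (Fin k) ℂ) :
    (∀ μ ∈ WilsonLoops.invariantFunctionals B ρ,
      WilsonLoops.IsAmbientIsotopyInvariant (WilsonLoops.loopTransform B ρ μ)) ∧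
    Set.InjOn (WilsonLoops.loopTransform B ρ) (WilsonLoops.invariantFunctionals B ρ) := by
  refine ⟨?_, (WilsonLoops.loopTransform_injective B ρ).injOn⟩
  rintro μ hμ _ η ⟨g, hg, rfl⟩
  -- Here `f` is the product of the `T(η_i)` and `gf` that of the `T(g ∘ η_i)`.
  exact hμ g hg _ _ (WilsonLoops.prod_wilsonLoop_mem_actionGraph B ρ g η.2)
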